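/- Let $f:\mathbb{R}\to\mathbb{R}$ be twice differentiable with $f>0$, $f'\ge 0$ and $f''>0$ on $\mathbb{R}$ and $\lim_{u\to\infty} f(u)/u=\infty$. Let $\alpha>0$ and $L_0>0$ be given, and put $F(u)=\int_0^u f(t)\,dt$. For $C>0$ and $\lambda>0$ let $(v_1,u_1)$, $v_1,u_1>0$, be the intersection point of the curve $F(u)=C-\frac{v^2}{2}$ with the line $u=\frac{\sqrt{\lambda}}{\alpha}v$, and let $$L(C;\lambda,\alpha)=2\int_0^{v_1}\frac{dv}{\sqrt{\lambda}\,f\left(F^{-1}\left(C-\frac{v^2}{2}\right)\right)} .$$ Then for every $C>0$ there is exactly one $\lambda=\lambda(C)>0$ with $L(C;\lambda,\alpha)=L_0$, and there exists $C^*>0$ such that $\lambda(C)$ is strictly increasing on $(0,C^*)$ and strictly decreasing on $(C^*,\infty)$. Moreover $\lim_{C\to 0^+}\lambda(C)=0$, $\lim_{C\to\infty}\lambda(C)=0$ and $\lambda(C^*)=\lambda^*$, where $\lambda^*\in(0,\infty)$ is the extremal parameter of the boundary value problem $$u''+\lambda f(u)=0\ \text{ in }(0,L_0),\qquad u'(0)=\alpha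 u(0),\qquad u'(L_0)=-\alpha u(L_0),$$ that is, this problem has a solution for every $0<\lambda\le\lambda^*$ and no solution for $\lambda>\lambda^*$. -/

import Mathlib

namespace RobinPhasePlane

/-- The primitive `F(u) = ∫₀ᵘ f`. -/
noncomputable def primitive (f : ℝ → ℝ) (u : ℝ) : ℝ := ∫ t in (0 : ℝ)..u, f t

/-- The inverse `F⁻¹`. When `f` is continuous and positive, `F` is injective, so this is the genuine
inverse on the range of `F`; the range contains `[0, ∞)` when moreover `f` is nondecreasing. -/
noncomputable def primitiveInv (f : ℝ → ℝ) : ℝ → ℝ := Function.invFun (primitive f)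

/-- The point `(v, u)` of the phase plane lies on the trajectory `F(u) = C - v² / 2` of level `C`. -/
def OnLevelCurve (f : ℝ → ℝ) (C v u : ℝ) : Prop := primitive f u = C - v ^ 2 / 2

/-- The point `(v, u)` lies on the line `u = γ v` with slope `γ = √lam / α`, which expresses the left
Robin condition `u'(0) = α u(0)` in terms of `v = u' / √lam`. -/
def OnRobinLine (α lam v u : ℝ) : Prop := u = Real.sqrt lam / α * v

/-- `L` is the length of the interval that belongs to the trajectory of level `C`:
`L = 2 ∫₀^{v₁} dv / (√lam f(F⁻¹(C - v²/2)))`, where `(v₁, u₁)` with `v₁, u₁ > 0` is the intersection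
point of the level curve and the Robin line. -/
def IsLength (f : ℝ → ℝ) (α lam C L : ℝ) : Prop :=
  ∃ v₁ u₁ : ℝ, 0 < v₁ ∧ 0 < u₁ ∧ OnLevelCurve f C v₁ u₁ ∧ OnRobinLine α lam v₁ u₁ ∧
    L = 2 * ∫ v in (0 : ℝ)..v₁, 1 / (Real.sqrt lam * f (primitiveInv f (C - v ^ 2 / 2)))

/-- `u` is a classical solution, `C¹` on `[0, L]`, of `u'' + lam f(u) = 0` in `(0, L)` with
`u'(0) = α u(0)` and `u'(L) = -α u(L)`; the function `p` is the derivative of `u`. -/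
def IsSolution (f : ℝ → ℝ) (α lam L : ℝ) (u : ℝ → ℝ) : Prop :=
  ∃ p : ℝ → ℝ,
    (∀ x ∈ Set.Icc 0 L, HasDerivWithinAt u (p x) (Set.Icc 0 L) x) ∧
    ContinuousOn p (Set.Icc 0 L) ∧
    (∀ x ∈ Set.Ioo 0 L, ∃ q : ℝ, HasDerivAt p q x ∧ q + lam * f (u x) = 0) ∧
    p 0 = α * u 0 ∧ p L = -α * u L

/-- `lamStar` is the extremal parameter: the boundary value problem on `(0, L)` is solvable for
every `0 < lam ≤ lamStar` and has no solution for `lam > lamStar`. -/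
def IsExtremalParameter (f : ℝ → ℝ) (α L lamStar : ℝ) : Prop :=
  0 < lamStar ∧
    (∀ lam : ℝ, 0 < lam → lam ≤ lamStar → ∃ u : ℝ → ℝ, IsSolution f α lam L u) ∧
    (∀ lam : ℝ, lamStar < lam → ¬ ∃ u : ℝ → ℝ, IsSolution f α lam L u)

end RobinPhasePlane

namespace RobinPhasePlane

/-! Rescale time by `√λ` and start at the apex, so that a trajectory of level `C` solves `p' = -v`,
`v' = f(p)`, `v(0) = 0`. If it reaches the Robin line at time `T`, then `L = 2T/√λ`. Imposing `L =
L₀` gives `√λ = 2T/L₀`, and the slope of the line becomes `kT` with `k = 2/(αL₀)`. Thus `λ` drops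
out: the crossing velocity solves `height = k * time * v`, whose two sides are strictly monotone in
opposite directions, so `λ(C) = (2T(C)/L₀)²` is unique.

The function `λ(C)` is continuous and positive. It vanishes as `C → 0` since `T ≤ √(2C)/f(0)`, and
as `C → ∞` by superlinearity (`sq_time_le`). The shape comes from `not_three_trajectories`: three
levels with the same `T` would reach the same line at the same time, which strict convexity excludes
by a Wronskian argument. A continuous positive function that vanishes at both ends and takes no
value three times must rise and then fall (`exists_unimodal`).

Finally, for `λ > 0`, solutions of the boundary value problem correspond to trajectories of length
`L₀`, so the solvable parameters are the range `(0, λ(C*)]`.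

On the negative half line `F` may be bounded (as for `exp`). Freezing `f` there gives a globally
invertible primitive without changing the trajectories where `u ≥ 0`. -/

/-! ### Primitives of positive functions and their inverses -/

lemma hasDerivAt_primitive {e : ℝ → ℝ} (he : Continuous e) (x : ℝ) :
    HasDerivAt (primitive e) (e x) x :=
  intervalIntegral.integral_hasDerivAt_right (he.intervalIntegrable _ _)
    he.aestronglyMeasurable.stronglyMeasurableAtFilter he.continuousAt

lemma continuous_primitive {e : ℝ → ℝ} (he : Continuous e) : Continuous (primitive e) :=
  continuous_iff_continuousAt.2 fun x => (hasDerivAt_primitive he x).continuousAt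

@[simp] lemma primitive_zero (e : ℝ → ℝ) : primitive e 0 = 0 := by simp [primitive]

lemma strictMono_primitive {e : ℝ → ℝ} (he : Continuous e) (hpos : ∀ x, 0 < e x) :
    StrictMono (primitive e) :=
  strictMono_of_hasDerivAt_pos (hasDerivAt_primitive he) hpos

lemma primitiveInv_primitive {e : ℝ → ℝ} (he : Continuous e) (hpos : ∀ x, 0 < e x) (x : ℝ) :
    primitiveInv e (primitive e x) = x :=
  Function.leftInverse_invFun (strictMono_primitive he hpos).injective x

/-- Since `e - c ≥ 0`, the primitive lies above the line `c x` for `x ≥ 0` and below it for `x ≤ 0`.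
-/
lemma surjective_primitive {e : ℝ → ℝ} (he : Continuous e) {c : ℝ} (hc : 0 < c)
    (hce : ∀ x, c ≤ e x) : Function.Surjective (primitive e) := by
  have hmono : Monotone fun x => primitive e x - c * x := by
    refine monotone_of_hasDerivAt_nonneg (f' := fun x => e x - c * 1)
      (fun x => (hasDerivAt_primitive he x).sub ((hasDerivAt_id x).const_mul c)) fun x => ?_
    have := hce x
    simp only [Pi.zero_apply]
    linarith
  refine (continuous_primitive he).surjective ?_ ?_
  · refine Filter.tendsto_atTop_mono' _ ?_ (Filter.tendsto_id.const_mul_atTop hc)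
    filter_upwards [Filter.eventually_ge_atTop 0] with x hx
    have := hmono hx
    simp at this ⊢
    linarith
  · refine Filter.tendsto_atBot_mono' _ ?_ (Filter.tendsto_id.const_mul_atBot hc)
    filter_upwards [Filter.eventually_le_atBot 0] with x hx
    have := hmono hx
    simp at this ⊢
    linarith

section Inverse

variable {e : ℝ → ℝ} (he : Continuous e) {c : ℝ} (hc : 0 < c) (hce : ∀ x, c ≤ e x)
include he hc hce

lemma primitive_primitiveInv (y : ℝ) : primitive e (primitiveInv e y) = y :=
  Function.rightInverse_invFun (surjective_primitive he hc hce) y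

lemma strictMono_primitiveInv : StrictMono (primitiveInv e) := fun a b hab => by
  rw [← (strictMono_primitive he fun x => hc.trans_le (hce x)).lt_iff_lt,
    primitive_primitiveInv he hc hce, primitive_primitiveInv he hc hce]
  exact hab

lemma continuous_primitiveInv : Continuous (primitiveInv e) := by
  refine (strictMono_primitiveInv he hc hce).monotone.continuous_of_surjective fun x => ?_
  exact ⟨_, primitiveInv_primitive he (fun x => hc.trans_le (hce x)) x⟩

lemma hasDerivAt_primitiveInv (y : ℝ) :
    HasDerivAt (primitiveInv e) (e (primitiveInv e y))⁻¹ y :=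
  HasDerivAt.of_local_left_inverse (continuous_primitiveInv he hc hce).continuousAt
    (hasDerivAt_primitive he _) (hc.trans_le (hce _)).ne'
    (Filter.Eventually.of_forall (primitive_primitiveInv he hc hce))

end Inverse

lemma primitiveInv_zero {e : ℝ → ℝ} (he : Continuous e) (hpos : ∀ x, 0 < e x) :
    primitiveInv e 0 = 0 := by
  simpa using primitiveInv_primitive he hpos 0

lemma primitive_neg_of_even {e : ℝ → ℝ} (hev : ∀ x, e (-x) = e x) (x : ℝ) :
    primitive e (-x) = -primitive e x := by
  have h := intervalIntegral.integral_comp_neg (a := 0) (b := x) e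
  simp only [hev, neg_zero] at h
  rw [primitive, primitive, h, intervalIntegral.integral_symm]

/-! ### Trajectories parametrized by the time from the apex -/

/-- The nonlinearity `f`, frozen at its value at `0` on the negative half line. -/
def trunc (f : ℝ → ℝ) (u : ℝ) : ℝ := f (max u 0)

lemma trunc_of_nonneg (f : ℝ → ℝ) {u : ℝ} (hu : 0 ≤ u) : trunc f u = f u := by
  rw [trunc, max_eq_left hu]

lemma primitive_trunc (f : ℝ → ℝ) {u : ℝ} (hu : 0 ≤ u) :
    primitive (trunc f) u = primitive f u := by
  refine intervalIntegral.integral_congr fun t ht => trunc_of_nonneg f ?_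
  rw [Set.uIcc_of_le hu] at ht
  exact ht.1

/-- The height of the trajectory of level `C` at velocity `v`. -/
noncomputable def height (f : ℝ → ℝ) (C v : ℝ) : ℝ := primitiveInv (trunc f) (C - v ^ 2 / 2)

/-- The rate of elapsed time with respect to velocity. -/
noncomputable def timeDensity (f : ℝ → ℝ) (C v : ℝ) : ℝ := (trunc f (height f C v))⁻¹

/-- The time that the trajectory of level `C` takes from its apex to velocity `v`. -/
noncomputable def time (f : ℝ → ℝ) (C v : ℝ) : ℝ := primitive (timeDensity f C) v

/-- The downward velocity at time `s` after the apex. -/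
noncomputable def velocity (f : ℝ → ℝ) (C s : ℝ) : ℝ := primitiveInv (timeDensity f C) s

/-- The position at time `s` after the apex. -/
noncomputable def position (f : ℝ → ℝ) (C s : ℝ) : ℝ := height f C (velocity f C s)

/-- The regularity, monotonicity and positivity used to parametrize trajectories. -/
structure Admissible (f : ℝ → ℝ) : Prop where
  continuous : Continuous f
  monotone : Monotone f
  pos : ∀ u, 0 < f u

namespace Admissible

variable {f : ℝ → ℝ} (hf : Admissible f)
include hf

lemma continuous_trunc : Continuous (trunc f) :=
  hf.continuous.comp (continuous_id.max continuous_const)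

lemma monotone_trunc : Monotone (trunc f) := fun _ _ h =>
  hf.monotone (max_le_max_right 0 h)

lemma trunc_pos (u : ℝ) : 0 < trunc f u := hf.pos _

lemma le_trunc (u : ℝ) : f 0 ≤ trunc f u := hf.monotone (le_max_right _ _)

lemma primitive_inverse_trunc (y : ℝ) : primitive (trunc f) (primitiveInv (trunc f) y) = y :=
  primitive_primitiveInv hf.continuous_trunc (hf.pos 0) hf.le_trunc y

lemma inverse_primitive_trunc (u : ℝ) : primitiveInv (trunc f) (primitive (trunc f) u) = u :=
  primitiveInv_primitive hf.continuous_trunc hf.trunc_pos u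

lemma strictMono_inverse : StrictMono (primitiveInv (trunc f)) :=
  strictMono_primitiveInv hf.continuous_trunc (hf.pos 0) hf.le_trunc

lemma continuous_inverse : Continuous (primitiveInv (trunc f)) :=
  continuous_primitiveInv hf.continuous_trunc (hf.pos 0) hf.le_trunc

lemma inverse_zero : primitiveInv (trunc f) 0 = 0 :=
  primitiveInv_zero hf.continuous_trunc hf.trunc_pos

lemma inverse_pos {y : ℝ} (hy : 0 < y) : 0 < primitiveInv (trunc f) y := by
  simpa [hf.inverse_zero] using hf.strictMono_inverse hy

/-- The truncated and the given primitive have the same inverse on `[0, ∞)`. -/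
lemma inverse_trunc {y : ℝ} (hy : 0 ≤ y) : primitiveInv f y = primitiveInv (trunc f) y := by
  have h0 : 0 ≤ primitiveInv (trunc f) y := by
    simpa [hf.inverse_zero] using hf.strictMono_inverse.monotone hy
  conv_lhs => rw [← hf.primitive_inverse_trunc y, primitive_trunc f h0]
  exact primitiveInv_primitive hf.continuous hf.pos _

lemma energy (C v : ℝ) : primitive (trunc f) (height f C v) + v ^ 2 / 2 = C := by
  rw [height, hf.primitive_inverse_trunc]; ring

lemma height_eq_of_energy {C v u : ℝ} (h : primitive (trunc f) u + v ^ 2 / 2 = C) :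
    height f C v = u := by
  rw [height, ← h, add_sub_cancel_right, hf.inverse_primitive_trunc]

lemma height_anti {C v w : ℝ} (h : v ^ 2 < w ^ 2) : height f C w < height f C v :=
  hf.strictMono_inverse (by linarith)

lemma continuous_height : Continuous fun q : ℝ × ℝ => height f q.1 q.2 :=
  hf.continuous_inverse.comp (by fun_prop)

lemma continuous_timeDensity : Continuous fun q : ℝ × ℝ => timeDensity f q.1 q.2 :=
  (hf.continuous_trunc.comp hf.continuous_height).inv₀ fun _ => (hf.trunc_pos _).ne'

lemma continuous_timeDensity_right (C : ℝ) : Continuous (timeDensity f C) :=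
  hf.continuous_timeDensity.comp (Continuous.prodMk_right C)

lemma timeDensity_pos (C v : ℝ) : 0 < timeDensity f C v := inv_pos.2 (hf.trunc_pos _)

/-- The height is largest at `v = 0`. This positive lower bound makes `time f C` a bijection of `ℝ`,
so that `velocity` is a genuine inverse for all times. -/
lemma le_timeDensity (C v : ℝ) : (trunc f (height f C 0))⁻¹ ≤ timeDensity f C v :=
  inv_anti₀ (hf.trunc_pos _) (hf.monotone_trunc (hf.strictMono_inverse.monotone
    (by nlinarith [sq_nonneg v])))

lemma timeDensity_le (C v : ℝ) : timeDensity f C v ≤ (f 0)⁻¹ :=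
  inv_anti₀ (hf.pos 0) (hf.le_trunc _)

lemma continuous_time : Continuous fun q : ℝ × ℝ => time f q.1 q.2 :=
  intervalIntegral.continuous_parametric_intervalIntegral_of_continuous
    (f := fun q : ℝ × ℝ => timeDensity f q.1)
    (hf.continuous_timeDensity.comp (by fun_prop : Continuous fun q : (ℝ × ℝ) × ℝ => (q.1.1, q.2)))
    continuous_snd

lemma hasDerivAt_time (C v : ℝ) : HasDerivAt (time f C) (timeDensity f C v) v :=
  hasDerivAt_primitive (hf.continuous_timeDensity_right C) v

lemma strictMono_time (C : ℝ) : StrictMono (time f C) :=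
  strictMono_primitive (hf.continuous_timeDensity_right C) (hf.timeDensity_pos C)

omit hf in
lemma time_zero (C : ℝ) : time f C 0 = 0 := primitive_zero _

lemma time_pos {C v : ℝ} (hv : 0 < v) : 0 < time f C v := by
  simpa [time_zero] using hf.strictMono_time C hv

omit hf in
lemma timeDensity_neg (C v : ℝ) : timeDensity f C (-v) = timeDensity f C v := by
  simp [timeDensity, height]

omit hf in
lemma time_neg (C v : ℝ) : time f C (-v) = -time f C v :=
  primitive_neg_of_even (timeDensity_neg C) v

lemma time_le {C v : ℝ} (hv : 0 ≤ v) : time f C v ≤ v * (f 0)⁻¹ := by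
  have h := intervalIntegral.integral_mono_on hv
    ((hf.continuous_timeDensity_right C).intervalIntegrable (μ := MeasureTheory.volume) 0 v)
    (continuous_const.intervalIntegrable 0 v) fun x _ => hf.timeDensity_le C x
  simpa [time, primitive] using h

lemma velocity_time (C v : ℝ) : velocity f C (time f C v) = v :=
  primitiveInv_primitive (hf.continuous_timeDensity_right C) (hf.timeDensity_pos C) v

lemma strictMono_velocity (C : ℝ) : StrictMono (velocity f C) :=
  strictMono_primitiveInv (hf.continuous_timeDensity_right C) (inv_pos.2 (hf.trunc_pos _))
    (hf.le_timeDensity C)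

lemma velocity_zero (C : ℝ) : velocity f C 0 = 0 :=
  primitiveInv_zero (hf.continuous_timeDensity_right C) (hf.timeDensity_pos C)

lemma velocity_nonneg {C s : ℝ} (hs : 0 ≤ s) : 0 ≤ velocity f C s := by
  simpa [hf.velocity_zero] using (hf.strictMono_velocity C).monotone hs

/-- The inverse function rule applied to `time`. With `hasDerivAt_position` it shows that `position`
solves `p'' + trunc f p = 0`. -/
lemma hasDerivAt_velocity (C s : ℝ) :
    HasDerivAt (velocity f C) (trunc f (position f C s)) s := by
  have h := hasDerivAt_primitiveInv (hf.continuous_timeDensity_right C)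
    (inv_pos.2 (hf.trunc_pos _)) (hf.le_timeDensity C) s
  exact h.congr_deriv (by simp [timeDensity, position, velocity])

lemma hasDerivAt_position (C s : ℝ) :
    HasDerivAt (position f C) (-velocity f C s) s := by
  have h := (hasDerivAt_primitiveInv hf.continuous_trunc (hf.pos 0) hf.le_trunc
    (C - velocity f C s ^ 2 / 2)).comp s
      ((((hf.hasDerivAt_velocity C s).pow 2).div_const 2).const_sub C)
  refine h.congr_deriv ?_
  have h0 : trunc f (position f C s) ≠ 0 := (hf.trunc_pos _).ne'
  change (trunc f (position f C s))⁻¹ * _ = _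
  field_simp
  norm_num

lemma position_energy (C s : ℝ) :
    primitive (trunc f) (position f C s) + velocity f C s ^ 2 / 2 = C := hf.energy C _

lemma strictMono_primitive_trunc : StrictMono (primitive (trunc f)) :=
  strictMono_primitive hf.continuous_trunc hf.trunc_pos

lemma antitoneOn_position (C : ℝ) : AntitoneOn (position f C) (Set.Ici 0) := fun s hs t ht h => by
  refine hf.strictMono_inverse.monotone ?_
  have h1 := hf.velocity_nonneg (C := C) hs
  have h2 := (hf.strictMono_velocity C).monotone h
  nlinarith

end Admissible
-- Comparison of trajectories and the convexity argument
namespace Admissible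

variable {f : ℝ → ℝ} (hf : Admissible f)
include hf

/-- Trajectories of different levels that reach the line `u = γ v` at the same time are ordered. -/
lemma position_lt_position {C D S γ : ℝ} (hCD : C < D) (hS : 0 < S) (hγ : 0 < γ)
    (hC : position f C S = γ * velocity f C S) (hD : position f D S = γ * velocity f D S)
    {s : ℝ} (hs : s ∈ Set.Icc 0 S) : position f C s < position f D s := by
  -- At time `S` heights and velocities are proportional with the same `γ`, so the lower point has
  -- the lower energy.
  have hend : position f C S < position f D S := by
    by_contra! h
    have h1 := hf.strictMono_primitive_trunc.monotone h
    have h2 : velocity f D S ≤ velocity f C S := by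
      rw [hC, hD] at h
      exact le_of_mul_le_mul_left h hγ
    have h3 := hf.velocity_nonneg (C := D) hS.le
    have h4 := hf.position_energy C S
    have h5 := hf.position_energy D S
    nlinarith
  by_contra! h
  have hw : ∀ x, HasDerivAt (fun x => position f D x - position f C x)
      (-velocity f D x - -velocity f C x) x := fun x =>
    (hf.hasDerivAt_position D x).sub (hf.hasDerivAt_position C x)
  -- Where the heights agree, the higher level moves down faster, so the difference crosses zero
  -- only downwards. Nonpositive at `s`, it would stay so up to `S`, against `hend`.
  have key := image_le_of_deriv_right_lt_deriv_boundary' (a := s) (b := S)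
    (f := fun x => position f D x - position f C x) (B := fun _ => 0) (B' := fun _ => 0)
    (fun x _ => (hw x).continuousAt.continuousWithinAt)
    (fun x _ => (hw x).hasDerivWithinAt) (by linarith) continuousOn_const
    (fun x _ => hasDerivWithinAt_const _ _ _) ?_ (Set.right_mem_Icc.2 hs.2)
  · linarith
  · intro x hx h0
    have h1 : position f D x = position f C x := by linarith
    have h4 := hf.position_energy C x
    have h5 := hf.position_energy D x
    rw [h1] at h5
    have h2 := hf.velocity_nonneg (C := C) (hs.1.trans hx.1)
    have h3 := hf.velocity_nonneg (C := D) (hs.1.trans hx.1)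
    nlinarith

/-- By strict convexity, at most two trajectories reach the line `u = γ v` at the same time. -/
lemma not_three_trajectories (hconv : StrictConvexOn ℝ Set.univ f) {A B C S γ : ℝ} (hAB : A < B)
    (hBC : B < C) (hS : 0 < S) (hγ : 0 < γ) (hpA : 0 < position f A S)
    (hA : position f A S = γ * velocity f A S) (hB : position f B S = γ * velocity f B S)
    (hC : position f C S = γ * velocity f C S) : False := by
  -- Wronskian of the differences `p_B - p_A` and `p_C - p_B`. In its derivative the products of
  -- velocities cancel.
  have hW : ∀ x, HasDerivAt (fun x =>
      (velocity f B x - velocity f A x) * (position f C x - position f B x) -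
        (velocity f C x - velocity f B x) * (position f B x - position f A x))
      ((trunc f (position f B x) - trunc f (position f A x)) * (position f C x - position f B x) +
        (velocity f B x - velocity f A x) * (-velocity f C x - -velocity f B x) -
       ((trunc f (position f C x) - trunc f (position f B x)) * (position f B x - position f A x) +
        (velocity f C x - velocity f B x) * (-velocity f B x - -velocity f A x))) x := fun x =>
    (((hf.hasDerivAt_velocity B x).sub (hf.hasDerivAt_velocity A x)).mul
      ((hf.hasDerivAt_position C x).sub (hf.hasDerivAt_position B x))).sub
    (((hf.hasDerivAt_velocity C x).sub (hf.hasDerivAt_velocity B x)).mul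
      ((hf.hasDerivAt_position B x).sub (hf.hasDerivAt_position A x)))
  -- Rolle: the Wronskian vanishes at `0`, where all velocities are zero, and at `S`, where all
  -- positions are `γ` times the velocities. A zero of its derivative equates two adjacent slopes of
  -- `f`.
  obtain ⟨x, hx, h0⟩ := exists_hasDerivAt_eq_zero hS
    (fun x _ => (hW x).continuousAt.continuousWithinAt)
    (by simp only [hf.velocity_zero, hA, hB, hC]; ring) fun x _ => hW x
  have hx' := Set.Ioo_subset_Icc_self hx
  have h1 := hf.position_lt_position hAB hS hγ hA hB hx'
  have h2 := hf.position_lt_position hBC hS hγ hB hC hx'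
  have h3 : 0 ≤ position f A x :=
    hpA.le.trans (hf.antitoneOn_position A hx'.1 hS.le hx'.2)
  rw [trunc_of_nonneg f h3, trunc_of_nonneg f (h3.trans h1.le),
    trunc_of_nonneg f (h3.trans (h1.trans h2).le)] at h0
  have h4 := hconv.slope_strict_mono_adjacent (Set.mem_univ _) (Set.mem_univ _) h1 h2
  rw [div_lt_div_iff₀ (by linarith) (by linarith)] at h4
  linarith

/-! ### The coupled Robin equation and its unique root -/

/-- The function of `v` whose zero is the velocity at the Robin line is strictly decreasing. -/
lemma strictAntiOn_robinGap {k : ℝ} (hk : 0 < k) (C : ℝ) :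
    StrictAntiOn (fun v => height f C v - k * time f C v * v) (Set.Ici 0) := by
  intro v hv w hw hvw
  have hv : 0 ≤ v := hv
  have h1 := hf.height_anti (C := C) (v := v) (w := w) (by nlinarith)
  have h2 := (hf.strictMono_time C).monotone hvw.le
  have h3 : 0 ≤ time f C v := by
    simpa [time_zero] using (hf.strictMono_time C).monotone hv
  have h4 : time f C v * v ≤ time f C w * w := mul_le_mul h2 hvw.le hv (h3.trans h2)
  have := mul_le_mul_of_nonneg_left h4 hk.le
  simp only [mul_assoc]
  linarith

lemma continuous_robinGap (k : ℝ) :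
    Continuous fun q : ℝ × ℝ => height f q.1 q.2 - k * time f q.1 q.2 * q.2 :=
  hf.continuous_height.sub ((hf.continuous_time.const_mul k).mul continuous_snd)

/-- The gap is positive at the apex `v = 0` and negative at `v = √(2C)`, where the height vanishes.
-/
lemma exists_robinVelocity {k : ℝ} (hk : 0 < k) {C : ℝ} (hC : 0 < C) :
    ∃ v, 0 < v ∧ v < √(2 * C) ∧ height f C v = k * time f C v * v := by
  have hr : 0 < √(2 * C) := Real.sqrt_pos.2 (by linarith)
  have h0 : 0 < height f C 0 := hf.inverse_pos (by simpa using hC)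
  have h1 : height f C (√(2 * C)) = 0 := by
    rw [height, Real.sq_sqrt (by linarith)]
    simpa using hf.inverse_zero
  have h2 := hf.time_pos (C := C) hr
  obtain ⟨v, hv, hv0⟩ := intermediate_value_Ioo' hr.le
    (((hf.continuous_robinGap k).comp (Continuous.prodMk_right C)).continuousOn)
    (show (0 : ℝ) ∈ Set.Ioo _ _ from
      ⟨by simp only [Function.comp, h1, zero_sub, neg_lt_zero]; positivity,
        by simpa [Function.comp] using h0⟩)
  exact ⟨v, hv.1, hv.2, sub_eq_zero.1 hv0⟩

end Admissible

open Classical in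
/-- The velocity `v₁` at which the trajectory of level `C` meets the Robin line, when the length of
the interval and the parameter are coupled; here `k = 2 / (α L₀)`. -/
noncomputable def robinVelocity (f : ℝ → ℝ) (k C : ℝ) : ℝ :=
  if h : ∃ v, 0 < v ∧ v < √(2 * C) ∧ height f C v = k * time f C v * v then h.choose else 0

/-- The time from the apex to the Robin line. -/
noncomputable def halfTime (f : ℝ → ℝ) (k C : ℝ) : ℝ := time f C (robinVelocity f k C)

namespace Admissible

variable {f : ℝ → ℝ} (hf : Admissible f) {k : ℝ} (hk : 0 < k)
include hf hk

lemma robinVelocity_spec {C : ℝ} (hC : 0 < C) :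
    0 < robinVelocity f k C ∧ robinVelocity f k C < √(2 * C) ∧
      height f C (robinVelocity f k C) = k * halfTime f k C * robinVelocity f k C := by
  have h := hf.exists_robinVelocity hk hC
  rw [halfTime, robinVelocity, dif_pos h]
  exact h.choose_spec

lemma eq_robinVelocity {C v : ℝ} (hC : 0 < C) (hv : 0 < v)
    (h : height f C v = k * time f C v * v) : v = robinVelocity f k C := by
  obtain ⟨h1, -, h2⟩ := hf.robinVelocity_spec hk hC
  refine (hf.strictAntiOn_robinGap hk C).injOn hv.le h1.le ?_
  simp only [h, sub_self]
  rw [h2, halfTime, sub_self]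

lemma halfTime_pos {C : ℝ} (hC : 0 < C) : 0 < halfTime f k C :=
  hf.time_pos (hf.robinVelocity_spec hk hC).1

omit hk in
lemma velocity_halfTime (C : ℝ) : velocity f C (halfTime f k C) = robinVelocity f k C :=
  hf.velocity_time C _

lemma position_halfTime (C : ℝ) (hC : 0 < C) :
    position f C (halfTime f k C) = k * halfTime f k C * velocity f C (halfTime f k C) := by
  rw [position, hf.velocity_halfTime]
  exact (hf.robinVelocity_spec hk hC).2.2

lemma position_halfTime_pos {C : ℝ} (hC : 0 < C) : 0 < position f C (halfTime f k C) := by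
  rw [hf.position_halfTime hk C hC, hf.velocity_halfTime]
  exact mul_pos (mul_pos hk (hf.halfTime_pos hk hC)) (hf.robinVelocity_spec hk hC).1

/-- Equal half times `S` give one common line, of slope `k * S`, reached at one common time. -/
lemma halfTime_not_three (hconv : StrictConvexOn ℝ Set.univ f) {A B C : ℝ} (hA : 0 < A)
    (hAB : A < B) (hBC : B < C) (h1 : halfTime f k A = halfTime f k B)
    (h2 : halfTime f k B = halfTime f k C) : False := by
  have hA' := hf.position_halfTime hk A hA
  have hB' := hf.position_halfTime hk B (hA.trans hAB)
  have hC' := hf.position_halfTime hk C (hA.trans (hAB.trans hBC))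
  rw [← h2, ← h1] at hC'
  rw [← h1] at hB'
  exact hf.not_three_trajectories hconv hAB hBC (hf.halfTime_pos hk hA)
    (mul_pos hk (hf.halfTime_pos hk hA)) (hf.position_halfTime_pos hk hA) hA' hB' hC'

/-- The gap is continuous in the level, so its signs on either side of the root persist for nearby
levels; being strictly decreasing in `v`, it then traps their roots. -/
lemma continuousAt_robinVelocity {C : ℝ} (hC : 0 < C) : ContinuousAt (robinVelocity f k) C := by
  have hgap : ∀ v, Filter.Tendsto (fun D => height f D v - k * time f D v * v) (nhds C)
      (nhds (height f C v - k * time f C v * v)) := fun v =>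
    ((hf.continuous_robinGap k).comp (Continuous.prodMk_left v)).continuousAt
  have hzero : ∀ D, 0 < D → height f D (robinVelocity f k D) -
      k * time f D (robinVelocity f k D) * robinVelocity f k D = 0 := fun D hD =>
    sub_eq_zero.2 (hf.robinVelocity_spec hk hD).2.2
  have hpos : ∀ D, 0 < D → 0 < robinVelocity f k D := fun D hD => (hf.robinVelocity_spec hk hD).1
  rw [ContinuousAt, tendsto_order]
  refine ⟨fun a ha => ?_, fun b hb => ?_⟩
  -- Monotonicity of the gap is available only for `v ≥ 0`; below that, positivity of the roots
  -- suffices.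
  · rcases lt_or_ge a 0 with ha0 | ha0
    · filter_upwards [lt_mem_nhds hC] with D hD using ha0.trans (hpos D hD)
    · have h := hf.strictAntiOn_robinGap hk C ha0 (hpos C hC).le ha
      simp only [hzero C hC] at h
      filter_upwards [lt_mem_nhds hC, (hgap a).eventually (lt_mem_nhds h)] with D hD hDa
      rw [← hzero D hD] at hDa
      exact ((hf.strictAntiOn_robinGap hk D).lt_iff_gt (hpos D hD).le ha0).1 hDa
  · have hb0 : 0 ≤ b := (hpos C hC).le.trans hb.le
    have h := hf.strictAntiOn_robinGap hk C (hpos C hC).le hb0 hb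
    simp only [hzero C hC] at h
    filter_upwards [lt_mem_nhds hC, (hgap b).eventually (gt_mem_nhds h)] with D hD hDa
    rw [← hzero D hD] at hDa
    exact ((hf.strictAntiOn_robinGap hk D).lt_iff_gt hb0 (hpos D hD).le).1 hDa

lemma continuousOn_halfTime : ContinuousOn (halfTime f k) (Set.Ioi 0) := fun _ hC =>
  (hf.continuous_time.continuousAt.comp
    (continuousAt_id.prodMk (hf.continuousAt_robinVelocity hk hC))).continuousWithinAt

/-! ### The half time for small and for large levels -/

lemma tendsto_halfTime_zero :
    Filter.Tendsto (halfTime f k) (nhdsWithin 0 (Set.Ioi 0)) (nhds 0) := by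
  -- The crossing velocity is below `√(2C)` and the time density is at most `1 / f 0`.
  have h : Filter.Tendsto (fun C : ℝ => √(2 * C) * (f 0)⁻¹) (nhdsWithin 0 (Set.Ioi 0)) (nhds 0) := by
    have : Continuous fun C : ℝ => √(2 * C) * (f 0)⁻¹ := by fun_prop
    simpa using (this.tendsto 0).mono_left nhdsWithin_le_nhds
  refine tendsto_of_tendsto_of_tendsto_of_le_of_le' tendsto_const_nhds h ?_ ?_
  · filter_upwards [self_mem_nhdsWithin] with C hC using (hf.halfTime_pos hk hC).le
  · filter_upwards [self_mem_nhdsWithin] with C hC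
    obtain ⟨h1, h2, -⟩ := hf.robinVelocity_spec hk hC
    exact (hf.time_le h1.le).trans
      (mul_le_mul_of_nonneg_right h2.le (inv_nonneg.2 (hf.pos 0).le))

omit hk in
lemma exists_position_sub {C a b : ℝ} (hab : a < b) :
    ∃ x ∈ Set.Ioo a b, position f C a - position f C b = velocity f C x * (b - a) := by
  obtain ⟨x, hx, h⟩ := exists_hasDerivAt_eq_slope (position f C) (fun x => -velocity f C x) hab
    (fun x _ => (hf.hasDerivAt_position C x).continuousAt.continuousWithinAt)
    (fun x _ => hf.hasDerivAt_position C x)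
  refine ⟨x, hx, ?_⟩
  rw [eq_div_iff (by linarith)] at h
  linarith

omit hk in
/-- A concave trajectory that stays positive up to time `S` falls slowly. -/
lemma sq_time_le {C S : ℝ} (hS : 0 < S) (hp : 0 < position f C S) :
    S ^ 2 * f (position f C 0 / 2) ≤ 8 * position f C 0 := by
  obtain ⟨x, hx, hx'⟩ := hf.exists_position_sub (C := C) (a := 0) (b := S / 2) (by linarith)
  obtain ⟨y, hy, hy'⟩ := hf.exists_position_sub (C := C) (a := S / 2) (b := S) (by linarith)
  obtain ⟨z, hz, hz'⟩ := hf.exists_position_sub (C := C) (a := S / 4) (b := S / 2) (by linarith)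
  have hxy := (hf.strictMono_velocity C).monotone (hx.2.trans hy.1).le
  -- By concavity the drop over the first half of `[0, S]` is at most that over the second, and the
  -- total is less than the apex height.
  have hmid : position f C 0 / 2 ≤ position f C (S / 2) := by nlinarith
  have h0 : 0 < position f C 0 :=
    hp.trans_le (hf.antitoneOn_position C (Set.mem_Ici.2 le_rfl) hS.le hS.le)
  obtain ⟨t, ht, ht'⟩ := exists_hasDerivAt_eq_slope (velocity f C)
    (fun x => trunc f (position f C x)) (show (0 : ℝ) < S / 4 by linarith)
    (fun x _ => (hf.hasDerivAt_velocity C x).continuousAt.continuousWithinAt)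
    (fun x _ => hf.hasDerivAt_velocity C x)
  rw [hf.velocity_zero, eq_div_iff (by linarith)] at ht'
  have htp : position f C 0 / 2 ≤ position f C t :=
    hmid.trans (hf.antitoneOn_position C ht.1.le (Set.mem_Ici.2 (by linarith)) (by linarith [ht.2]))
  have hft : f (position f C 0 / 2) ≤ trunc f (position f C t) := by
    rw [trunc_of_nonneg f (by linarith)]
    exact hf.monotone htp
  have hzv := (hf.strictMono_velocity C).monotone hz.1.le
  have hup : position f C (S / 4) ≤ position f C 0 :=
    hf.antitoneOn_position C (Set.mem_Ici.2 le_rfl) (Set.mem_Ici.2 (by linarith)) (by linarith)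
  -- Write `A` for the apex height. On `[0, S/4]` the acceleration is at least `f(A/2)`, so the drop
  -- over `[S/4, S/2]` is at least `f(A/2) S²/16`. It is at most `A/2`, whence the constant `8`.
  have h1 : f (position f C 0 / 2) * (S / 4) ≤ velocity f C z := by nlinarith
  have h2 : f (position f C 0 / 2) * (S / 4) * (S / 4) ≤ velocity f C z * (S / 4) :=
    mul_le_mul_of_nonneg_right h1 (by linarith)
  nlinarith

omit hk in
lemma tendsto_apex : Filter.Tendsto (fun C => position f C 0) Filter.atTop Filter.atTop := by
  have h : (fun C => position f C 0) = primitiveInv (trunc f) := by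
    funext C
    simp [position, height, hf.velocity_zero]
  rw [h]
  exact hf.strictMono_inverse.monotone.tendsto_atTop_atTop fun b =>
    ⟨primitive (trunc f) b, (hf.inverse_primitive_trunc b).ge⟩

/-- With apex height `A → ∞`, `sq_time_le` reads `T² ≤ 16 (A/2) / f(A/2)`, which tends to `0` by
superlinearity. -/
lemma tendsto_halfTime_atTop (hsuper : Filter.Tendsto (fun u => f u / u) Filter.atTop Filter.atTop) :
    Filter.Tendsto (halfTime f k) Filter.atTop (nhds 0) := by
  have hlim : Filter.Tendsto (fun C => √(16 * (f (position f C 0 / 2) / (position f C 0 / 2))⁻¹))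
      Filter.atTop (nhds 0) := by
    have h := (hsuper.comp (hf.tendsto_apex.atTop_div_const (show (0 : ℝ) < 2 by norm_num)))
    simpa using ((h.inv_tendsto_atTop).const_mul 16).sqrt
  refine tendsto_of_tendsto_of_tendsto_of_le_of_le' tendsto_const_nhds hlim ?_ ?_
  · filter_upwards [Filter.eventually_gt_atTop 0] with C hC using (hf.halfTime_pos hk hC).le
  · filter_upwards [Filter.eventually_gt_atTop 0] with C hC
    refine Real.le_sqrt_of_sq_le ?_
    have h := hf.sq_time_le (hf.halfTime_pos hk hC) (hf.position_halfTime_pos hk hC)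
    rw [← le_div_iff₀ (hf.pos _)] at h
    refine h.trans (le_of_eq ?_)
    rw [inv_div]
    ring

end Admissible

/-! ### Unimodality from the absence of triple values -/

/-- A positive continuous function on `(0, ∞)` that vanishes at both ends and takes no value three
times is strictly increasing and then strictly decreasing. -/
lemma exists_unimodal {g : ℝ → ℝ} (hc : ContinuousOn g (Set.Ioi 0)) (hpos : ∀ x, 0 < x → 0 < g x)
    (hzero : Filter.Tendsto g (nhdsWithin 0 (Set.Ioi 0)) (nhds 0))
    (htop : Filter.Tendsto g Filter.atTop (nhds 0))
    (hthree : ∀ a b c, 0 < a → a < b → b < c → g a = g b → g b = g c → False) :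
    ∃ m, 0 < m ∧ StrictMonoOn g (Set.Ioo 0 m) ∧ StrictAntiOn g (Set.Ioi m) ∧
      (∀ x, 0 < x → g x ≤ g m) ∧ ∀ y, 0 < y → y ≤ g m → ∃ x, 0 < x ∧ g x = y := by
  have hsub : ∀ {a b : ℝ}, 0 < a → ContinuousOn g (Set.Icc a b) := fun ha =>
    hc.mono fun x hx => ha.trans_le hx.1
  have hleft : ∀ a, 0 < a → ∀ y, 0 < y → y < g a → ∃ x, 0 < x ∧ x < a ∧ g x = y := by
    intro a ha y hy hya
    obtain ⟨x₀, hx₀, hx₀a, hx₀0⟩ := ((hzero.eventually (gt_mem_nhds hy)).and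
      ((Filter.Eventually.filter_mono nhdsWithin_le_nhds (gt_mem_nhds ha)).and
        (self_mem_nhdsWithin : Set.Ioi (0 : ℝ) ∈ nhdsWithin 0 (Set.Ioi 0)))).exists
    obtain ⟨x, hx, hxy⟩ := intermediate_value_Ioo (le_of_lt hx₀a) (hsub hx₀0) ⟨hx₀, hya⟩
    exact ⟨x, lt_trans hx₀0 hx.1, hx.2, hxy⟩
  have hright : ∀ a, 0 < a → ∀ y, 0 < y → y < g a → ∃ x, a < x ∧ g x = y := by
    intro a ha y hy hya
    obtain ⟨x₀, hx₀, hx₀a⟩ := ((htop.eventually (gt_mem_nhds hy)).and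
      (Filter.eventually_gt_atTop a)).exists
    obtain ⟨x, hx, hxy⟩ := intermediate_value_Ioo' hx₀a.le (hsub ha) ⟨hx₀, hya⟩
    exact ⟨x, hx.1, hxy⟩
  -- Near both ends `g` is below `g 1`, so a maximum over a compact interval containing `1` is
  -- global.
  obtain ⟨m, hm, hmax⟩ : ∃ m, 0 < m ∧ ∀ x, 0 < x → g x ≤ g m := by
    have h1 := hpos 1 one_pos
    obtain ⟨a, ha0, ha⟩ := mem_nhdsGT_iff_exists_Ioo_subset.1
      (hzero.eventually (gt_mem_nhds h1))
    obtain ⟨b, hb⟩ := Filter.eventually_atTop.1 (htop.eventually (gt_mem_nhds h1))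
    have ha0 : 0 < a := ha0
    have hmem : (1 : ℝ) ∈ Set.Icc (min a 1) (max b 1) := ⟨min_le_right _ _, le_max_right _ _⟩
    have hmin : 0 < min a 1 := lt_min ha0 one_pos
    obtain ⟨m, hm, hmx⟩ := isCompact_Icc.exists_isMaxOn ⟨1, hmem⟩
      (hsub (b := max b 1) hmin)
    refine ⟨m, hmin.trans_le hm.1, fun x hx => ?_⟩
    by_cases hxa : x < min a 1
    · exact (ha ⟨hx, hxa.trans_le (min_le_left _ _)⟩).le.trans (hmx hmem)
    by_cases hxb : max b 1 < x
    · exact (hb x ((le_max_left _ _).trans hxb.le)).le.trans (hmx hmem)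
    exact hmx ⟨not_lt.1 hxa, not_lt.1 hxb⟩
  refine ⟨m, hm, ?_, ?_, hmax, ?_⟩
  · intro a ha b hb hab
    by_contra! h
    rcases h.lt_or_eq with h | h
    -- If `g b < g a`, an intermediate value is taken left of `a`, between `a` and `b`, and between
    -- `b` and `m`.
    · obtain ⟨y, hby, hya⟩ := exists_between h
      have hy := (hpos b hb.1).trans hby
      obtain ⟨x₁, h10, h11, h12⟩ := hleft a ha.1 y hy hya
      obtain ⟨x₂, h20, h21⟩ := intermediate_value_Ioo' hab.le (hsub ha.1) ⟨hby, hya⟩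
      obtain ⟨x₃, h30, h31⟩ := intermediate_value_Ioo hb.2.le (hsub hb.1)
        ⟨hby, hya.trans_le (hmax a ha.1)⟩
      exact hthree x₁ x₂ x₃ h10 (h11.trans h20.1) (h20.2.trans h30.1) (h12.trans h21.symm)
        (h21.trans h31.symm)
    -- If `g a = g b`, the third point is `m` itself or lies to the right of `m`.
    · rcases (hmax b hb.1).lt_or_eq with h' | h'
      · obtain ⟨x, hx, hxb⟩ := hright m hm _ (hpos b hb.1) h'
        exact hthree a b x ha.1 hab (hb.2.trans hx) h.symm hxb.symm
      · exact hthree a b m ha.1 hab hb.2 h.symm h'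
  · intro a ha b hb hab
    have ha0 : 0 < a := hm.trans ha
    have hb0 : 0 < b := hm.trans hb
    by_contra! h
    rcases h.lt_or_eq with h | h
    · obtain ⟨y, hay, hyb⟩ := exists_between h
      have hy := (hpos a ha0).trans hay
      obtain ⟨x₁, h10, h11⟩ := intermediate_value_Ioo' (le_of_lt ha) (hsub hm)
        ⟨hay, hyb.trans_le (hmax b hb0)⟩
      obtain ⟨x₂, h20, h21⟩ := intermediate_value_Ioo hab.le (hsub ha0) ⟨hay, hyb⟩
      obtain ⟨x₃, h30, h31⟩ := hright b hb0 y hy hyb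
      exact hthree x₁ x₂ x₃ (hm.trans h10.1) (h10.2.trans h20.1) (h20.2.trans h30)
        (h11.trans h21.symm) (h21.trans h31.symm)
    · rcases (hmax a ha0).lt_or_eq with h' | h'
      · obtain ⟨x, hx0, hx, hxb⟩ := hleft m hm _ (hpos a ha0) h'
        exact hthree x a b hx0 (hx.trans ha) hab hxb h
      · exact hthree m a b hm ha hab h'.symm h
  · intro y hy hym
    rcases hym.lt_or_eq with h | h
    · obtain ⟨x, hx, -, hxy⟩ := hleft m hm y hy h
      exact ⟨x, hx, hxy⟩
    · exact ⟨m, hm, h.symm⟩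

/-! ### Length condition and parameter -/

/-- The parameter for which the trajectory of level `C` has length `L`. -/
noncomputable def robinParameter (f : ℝ → ℝ) (α L C : ℝ) : ℝ :=
  (2 * halfTime f (2 / (α * L)) C / L) ^ 2

namespace Admissible

variable {f : ℝ → ℝ} (hf : Admissible f)
include hf

/-- Heights on `[0, v]` are at least the height at `v`, hence nonnegative, so the truncation is
invisible. -/
lemma integral_eq_time {C v : ℝ} (μ : ℝ) (hv : 0 ≤ v) (hh : 0 ≤ height f C v) :
    ∫ w in (0 : ℝ)..v, 1 / (√μ * f (primitiveInv f (C - w ^ 2 / 2))) = time f C v / √μ := by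
  rw [time, primitive, ← intervalIntegral.integral_div]
  refine intervalIntegral.integral_congr fun w hw => ?_
  rw [Set.uIcc_of_le hv] at hw
  have h1 : C - v ^ 2 / 2 ≤ C - w ^ 2 / 2 := by nlinarith [hw.1, hw.2]
  have h2 : 0 ≤ C - v ^ 2 / 2 := by
    have := hf.strictMono_primitive_trunc.monotone hh
    have h3 := hf.energy C v
    rw [primitive_zero] at this
    linarith
  have h3 : 0 ≤ height f C w := hh.trans (hf.strictMono_inverse.monotone h1)
  have h4 : primitiveInv f (C - w ^ 2 / 2) = height f C w := hf.inverse_trunc (h2.trans h1)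
  simp only [h4, timeDensity, trunc_of_nonneg f h3]
  rw [one_div, mul_inv, div_eq_mul_inv, mul_comm]

lemma isLength_iff {α μ C L : ℝ} (hα : 0 < α) (hμ : 0 < μ) :
    IsLength f α μ C L ↔ ∃ v, 0 < v ∧ height f C v = √μ / α * v ∧ √μ * L = 2 * time f C v := by
  have hs : 0 < √μ := Real.sqrt_pos.2 hμ
  constructor
  · rintro ⟨v, u, hv, hu, hcurve, hline, hL⟩
    have hh : height f C v = u := hf.height_eq_of_energy (by
      rw [primitive_trunc f hu.le, hcurve]; ring)
    rw [hf.integral_eq_time μ hv.le (hh ▸ hu.le)] at hL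
    exact ⟨v, hv, hh.trans hline, by rw [hL]; field_simp⟩
  · rintro ⟨v, hv, hh, hL⟩
    have hu : 0 < height f C v := by rw [hh]; positivity
    refine ⟨v, height f C v, hv, hu, ?_, hh, ?_⟩
    · have := hf.energy C v
      rw [primitive_trunc f hu.le] at this
      rw [OnLevelCurve]
      linarith
    · rw [hf.integral_eq_time μ hv.le hu.le]
      field_simp
      linarith

/-- The length condition says `√μ = 2 * time / L`. Inserting this in the Robin line yields the
equation that characterizes `robinVelocity`, which no longer contains `μ`. -/
lemma isLength_iff_eq_robinParameter {α L C : ℝ} (hα : 0 < α) (hL : 0 < L) (hC : 0 < C) (μ : ℝ) :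
    (0 < μ ∧ IsLength f α μ C L) ↔ μ = robinParameter f α L C := by
  have hk : 0 < 2 / (α * L) := by positivity
  constructor
  · rintro ⟨hμ, h⟩
    obtain ⟨v, hv, hh, hT⟩ := (hf.isLength_iff hα hμ).1 h
    have hs : √μ = 2 * time f C v / L := by field_simp; exact hT
    have hv' : v = robinVelocity f (2 / (α * L)) C := hf.eq_robinVelocity hk hC hv (by
      rw [hh, hs]; field_simp)
    rw [robinParameter, halfTime, ← hv', ← hs, Real.sq_sqrt hμ.le]
  · rintro rfl
    have hS := hf.halfTime_pos hk hC
    have hμ : 0 < robinParameter f α L C := by rw [robinParameter]; positivity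
    have hs : √(robinParameter f α L C) = 2 * halfTime f (2 / (α * L)) C / L :=
      Real.sqrt_sq (by positivity)
    obtain ⟨h1, -, h2⟩ := hf.robinVelocity_spec hk hC
    refine ⟨hμ, (hf.isLength_iff hα hμ).2 ⟨_, h1, ?_, ?_⟩⟩
    · rw [h2, hs]; field_simp
    · rw [hs, halfTime]; field_simp

/-! ### Trajectories and solutions of the boundary value problem -/

/-- Every trajectory with the right length solves the boundary value problem. -/
lemma exists_isSolution {α μ C L : ℝ} (hα : 0 < α) (hμ : 0 < μ)
    (h : IsLength f α μ C L) : ∃ u, IsSolution f α μ L u := by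
  obtain ⟨v, hv, hh, hT⟩ := (hf.isLength_iff hα hμ).1 h
  have hs : 0 < √μ := Real.sqrt_pos.2 hμ
  have hμs : √μ * √μ = μ := Real.mul_self_sqrt hμ.le
  -- The solution is the trajectory with its apex placed at the midpoint `L / 2`.
  have hlin : ∀ x, HasDerivAt (fun x => √μ * (x - L / 2)) (√μ) x := fun x => by
    simpa using ((hasDerivAt_id x).sub_const (L / 2)).const_mul (√μ)
  have hu : ∀ x, HasDerivAt (fun x => position f C (√μ * (x - L / 2)))
      (-velocity f C (√μ * (x - L / 2)) * √μ) x := fun x =>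
    (hf.hasDerivAt_position C _).comp x (hlin x)
  have hp : ∀ x, HasDerivAt (fun x => -velocity f C (√μ * (x - L / 2)) * √μ)
      (-(trunc f (position f C (√μ * (x - L / 2))) * √μ) * √μ) x := fun x =>
    (((hf.hasDerivAt_velocity C _).comp x (hlin x)).neg).mul_const _
  have hend : velocity f C (√μ * (L - L / 2)) = v := by
    rw [← hf.velocity_time C v]
    congr 1
    linarith
  have hstart : velocity f C (√μ * (0 - L / 2)) = -v := by
    rw [← hf.velocity_time C (-v), time_neg]
    congr 1
    linarith
  refine ⟨_, fun x => -velocity f C (√μ * (x - L / 2)) * √μ, fun x _ => (hu x).hasDerivWithinAt,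
    fun x _ => (hp x).continuousAt.continuousWithinAt, fun x hx => ⟨_, hp x, ?_⟩, ?_, ?_⟩
  · have h1 : -v ≤ velocity f C (√μ * (x - L / 2)) := by
      rw [← hstart]
      exact (hf.strictMono_velocity C).monotone
        (mul_le_mul_of_nonneg_left (by linarith [hx.1]) hs.le)
    have h2 : velocity f C (√μ * (x - L / 2)) ≤ v := by
      rw [← hend]
      exact (hf.strictMono_velocity C).monotone
        (mul_le_mul_of_nonneg_left (by linarith [hx.2]) hs.le)
    have h3 : 0 ≤ position f C (√μ * (x - L / 2)) := by
      have h4 : 0 ≤ height f C v := by rw [hh]; positivity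
      exact h4.trans (hf.strictMono_inverse.monotone (by nlinarith))
    rw [trunc_of_nonneg f h3]
    linear_combination (-f (position f C (√μ * (x - L / 2)))) * hμs
  · simp only [position, hstart]
    rw [show height f C (-v) = height f C v by simp [height], hh]
    field_simp
  · simp only [position, hend, hh]
    field_simp

end Admissible

/-- A solution of the boundary value problem is positive. -/
lemma IsSolution.pos {f : ℝ → ℝ} (hpos : ∀ u, 0 < f u) {α μ L : ℝ} (hα : 0 < α) (hμ : 0 < μ)
    (hL : 0 < L) {u p : ℝ → ℝ}
    (hu : ∀ x ∈ Set.Icc 0 L, HasDerivWithinAt u (p x) (Set.Icc 0 L) x)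
    (hp : ContinuousOn p (Set.Icc 0 L))
    (hq : ∀ x ∈ Set.Ioo 0 L, HasDerivAt p (-(μ * f (u x))) x)
    (h0 : p 0 = α * u 0) (h1 : p L = -α * u L) : ∀ x ∈ Set.Icc 0 L, 0 < u x := by
  have hanti : StrictAntiOn p (Set.Icc 0 L) := by
    refine strictAntiOn_of_deriv_neg (convex_Icc 0 L) hp fun x hx => ?_
    rw [interior_Icc] at hx
    rw [(hq x hx).deriv]
    have := mul_pos hμ (hpos (u x))
    linarith
  have huc : ContinuousOn u (Set.Icc 0 L) := fun x hx => (hu x hx).continuousWithinAt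
  have hmvt : ∀ a b, 0 ≤ a → a < b → b ≤ L → ∃ x ∈ Set.Ioo a b, u b - u a = p x * (b - a) := by
    intro a b ha hab hb
    obtain ⟨x, hx, h⟩ := exists_hasDerivAt_eq_slope u p hab (huc.mono (Set.Icc_subset_Icc ha hb))
      fun x hx => (hu x ⟨ha.trans hx.1.le, hx.2.le.trans hb⟩).hasDerivAt
        (Icc_mem_nhds (ha.trans_lt hx.1) (hx.2.trans_le hb))
    refine ⟨x, hx, ?_⟩
    rw [h, div_mul_cancel₀ _ (by linarith)]
  have hm0 : (0 : ℝ) ∈ Set.Icc 0 L := ⟨le_rfl, hL.le⟩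
  have hmL : L ∈ Set.Icc 0 L := ⟨hL.le, le_rfl⟩
  -- Strict concavity gives `p L < p 0`, that is `-α u(L) < α u(0)`.
  have hsum : 0 < u 0 + u L := by
    have := hanti hm0 hmL hL
    rw [h0, h1] at this
    by_contra! h
    nlinarith
  obtain ⟨y, hy, hy'⟩ := hmvt 0 L le_rfl hL le_rfl
  have hy0 := hanti hm0 ⟨hy.1.le, hy.2.le⟩ hy.1
  have hyL := hanti ⟨hy.1.le, hy.2.le⟩ hmL hy.2
  -- If `u 0 ≤ 0`, then `p ≤ 0` at the left end, so `u` decreases and `u L < u 0 ≤ 0`, against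
  -- `hsum`.
  have hu0 : 0 < u 0 := by
    by_contra! h
    have : p y < 0 := by nlinarith
    nlinarith
  have huL : 0 < u L := by
    by_contra! h
    have : 0 < p y := by nlinarith
    nlinarith
  intro x hx
  rcases hx.1.eq_or_lt with rfl | hx0
  · exact hu0
  rcases hx.2.eq_or_lt with rfl | hxL
  · exact huL
  rcases le_total 0 (p x) with h | h
  · obtain ⟨z, hz, hz'⟩ := hmvt 0 x le_rfl hx0 hx.2
    have := hanti ⟨hz.1.le, hz.2.le.trans hx.2⟩ hx hz.2
    nlinarith [mul_pos (h.trans_lt this) hx0]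
  · obtain ⟨z, hz, hz'⟩ := hmvt x L hx.1 hxL le_rfl
    have := hanti hx ⟨hx.1.trans hz.1.le, hz.2.le⟩ hz.1
    nlinarith [mul_pos (sub_pos.2 hxL) (neg_pos.2 (this.trans_le h))]

/-- Serves both for conservation of energy (`c = 0`) and for the elapsed time (`c = -√μ`). -/
lemma sub_eq_of_hasDerivAt_const {g : ℝ → ℝ} {a b c : ℝ} (hg : ContinuousOn g (Set.Icc a b))
    (hd : ∀ x ∈ Set.Ioo a b, HasDerivAt g c x) {x : ℝ} (hx : x ∈ Set.Icc a b) :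
    g x - g a = c * (x - a) := by
  rcases hx.1.eq_or_lt with rfl | hax
  · simp
  obtain ⟨y, -, h⟩ := exists_hasDerivAt_eq_slope g (fun _ => c) hax
    (hg.mono (Set.Icc_subset_Icc_right hx.2)) fun y hy => hd y ⟨hy.1, hy.2.trans_le hx.2⟩
  rw [h, div_mul_cancel₀ _ (by linarith)]

/-- Every solution of the boundary value problem is a trajectory of positive level. -/
lemma Admissible.exists_isLength {f : ℝ → ℝ} (hf : Admissible f) {α μ L : ℝ} (hα : 0 < α)
    (hμ : 0 < μ) (hL : 0 < L) {u : ℝ → ℝ} (h : IsSolution f α μ L u) :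
    ∃ C, 0 < C ∧ IsLength f α μ C L := by
  obtain ⟨p, hu, hp, hq, h0, h1⟩ := h
  have hq : ∀ x ∈ Set.Ioo 0 L, HasDerivAt p (-(μ * f (u x))) x := fun x hx => by
    obtain ⟨q, hq, hq'⟩ := hq x hx
    rwa [← eq_neg_of_add_eq_zero_left hq']
  have hupos := IsSolution.pos hf.pos hα hμ hL hu hp hq h0 h1
  have huc : ContinuousOn u (Set.Icc 0 L) := fun x hx => (hu x hx).continuousWithinAt
  have hud : ∀ x ∈ Set.Ioo 0 L, HasDerivAt u (p x) x := fun x hx =>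
    (hu x ⟨hx.1.le, hx.2.le⟩).hasDerivAt (Icc_mem_nhds hx.1 hx.2)
  have hm0 : (0 : ℝ) ∈ Set.Icc 0 L := ⟨le_rfl, hL.le⟩
  have hmL : L ∈ Set.Icc 0 L := ⟨hL.le, le_rfl⟩
  have hs : 0 < √μ := Real.sqrt_pos.2 hμ
  have hsq : √μ ^ 2 = μ := Real.sq_sqrt hμ.le
  have henergy : ∀ x ∈ Set.Icc 0 L, primitive (trunc f) (u x) + (p x / √μ) ^ 2 / 2 =
      primitive (trunc f) (u 0) + (p 0 / √μ) ^ 2 / 2 := fun x hx => by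
    have := sub_eq_of_hasDerivAt_const (c := 0)
      (g := fun x => primitive (trunc f) (u x) + (p x / √μ) ^ 2 / 2)
      (((continuous_primitive hf.continuous_trunc).comp_continuousOn huc).add
        (((hp.div_const _).pow 2).div_const 2)) (fun x hx => ?_) hx
    · linarith
    · refine (((hasDerivAt_primitive hf.continuous_trunc _).comp x (hud x hx)).add
        ((((hq x hx).div_const (√μ)).pow 2).div_const 2)).congr_deriv ?_
      rw [trunc_of_nonneg f (hupos x ⟨hx.1.le, hx.2.le⟩).le]
      simp only [Nat.cast_ofNat, Nat.add_one_sub_one, pow_one]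
      field_simp
      rw [hsq]
      ring
  set C := primitive (trunc f) (u 0) + (p 0 / √μ) ^ 2 / 2 with hCdef
  have hheight : ∀ x ∈ Set.Icc 0 L, height f C (p x / √μ) = u x := fun x hx =>
    hf.height_eq_of_energy (henergy x hx)
  have hv : 0 < p 0 / √μ := by
    rw [h0]
    have := hupos 0 hm0
    positivity
  have hF0 : 0 < primitive (trunc f) (u 0) := by
    simpa using hf.strictMono_primitive_trunc (hupos 0 hm0)
  -- By the Robin conditions the energy at either end is the same strictly increasing function of
  -- the positive end value, `F(u) + α² u² / (2μ)`.
  have hsymm : u L = u 0 := by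
    have hE := henergy L hmL
    rw [hCdef, h0, h1, div_pow, div_pow, mul_pow, mul_pow, neg_sq] at hE
    have ha := hupos 0 hm0
    have hb := hupos L hmL
    have hk : 0 < α ^ 2 / √μ ^ 2 / 2 := by positivity
    rcases lt_trichotomy (u L) (u 0) with h | h | h
    · have := hf.strictMono_primitive_trunc h
      have h2 : u L ^ 2 < u 0 ^ 2 := by nlinarith
      have := mul_lt_mul_of_pos_left h2 hk
      ring_nf at hE this
      linarith
    · exact h
    · have := hf.strictMono_primitive_trunc h
      have h2 : u 0 ^ 2 < u L ^ 2 := by nlinarith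
      have := mul_lt_mul_of_pos_left h2 hk
      ring_nf at hE this
      linarith
  -- Along the solution the trajectory time runs at constant rate `-√μ`. Its end values are opposite
  -- because `p L = -p 0`, so `2 * time = √μ * L`.
  have htime := sub_eq_of_hasDerivAt_const (c := -√μ) (g := fun x => time f C (p x / √μ))
    (a := 0) (b := L) (fun x hx => (hf.hasDerivAt_time C _).continuousAt.comp_continuousWithinAt
      ((hp.div_const _) x hx)) (fun x hx => by
      have hx' : x ∈ Set.Icc 0 L := ⟨hx.1.le, hx.2.le⟩
      refine ((hf.hasDerivAt_time C _).comp x ((hq x hx).div_const (√μ))).congr_deriv ?_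
      rw [timeDensity, hheight x hx', trunc_of_nonneg f (hupos x hx').le]
      have := (hf.pos (u x)).ne'
      field_simp
      rw [hsq]) hmL
  have hpL : p L / √μ = -(p 0 / √μ) := by rw [h1, h0, hsymm]; ring
  simp only [hpL, Admissible.time_neg] at htime
  refine ⟨C, by positivity, (hf.isLength_iff hα hμ).2 ⟨_, hv, ?_, ?_⟩⟩
  · rw [hheight 0 hm0, h0]
    field_simp
  · linarith

end RobinPhasePlane

/-! ### The theorem -/

open RobinPhasePlane in
theorem mainTheorem4 (f : ℝ → ℝ)
    (hf1 : Differentiable ℝ f) (hf2 : Differentiable ℝ (deriv f))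
    (hpos : ∀ u, 0 < f u) (hmono : ∀ u, 0 ≤ deriv f u)
    (hsuper : Filter.Tendsto (fun u => f u / u) Filter.atTop Filter.atTop)
    (hconv : ∀ u, 0 < deriv (deriv f) u)
    (α : ℝ) (hα : 0 < α) (L₀ : ℝ) (hL₀ : 0 < L₀) :
    ∃ lam : ℝ → ℝ,
      (∀ C : ℝ, 0 < C → ∀ μ : ℝ,
        (0 < μ ∧ RobinPhasePlane.IsLength f α μ C L₀) ↔ μ = lam C) ∧
      Filter.Tendsto lam (nhdsWithin 0 (Set.Ioi 0)) (nhds 0) ∧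
      Filter.Tendsto lam Filter.atTop (nhds 0) ∧
      ∃ Cstar : ℝ, 0 < Cstar ∧
        StrictMonoOn lam (Set.Ioo 0 Cstar) ∧
        StrictAntiOn lam (Set.Ioi Cstar) ∧
        RobinPhasePlane.IsExtremalParameter f α L₀ (lam Cstar) := by
  have hf : Admissible f := ⟨hf1.continuous, monotone_of_deriv_nonneg hf1 hmono, hpos⟩
  have hsc : StrictConvexOn ℝ Set.univ f :=
    strictConvexOn_univ_of_deriv2_pos hf1.continuous fun x => by simpa using hconv x
  have hk : 0 < 2 / (α * L₀) := by positivity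
  have hiff := fun {C : ℝ} (hC : 0 < C) (μ : ℝ) =>
    hf.isLength_iff_eq_robinParameter hα hL₀ hC μ
  have hlampos : ∀ C, 0 < C → 0 < robinParameter f α L₀ C := fun C hC => ((hiff hC _).2 rfl).1
  have hzero : Filter.Tendsto (robinParameter f α L₀) (nhdsWithin 0 (Set.Ioi 0)) (nhds 0) := by
    have h := (((hf.tendsto_halfTime_zero hk).const_mul 2).div_const L₀).pow 2
    rwa [mul_zero, zero_div, zero_pow two_ne_zero] at h
  have htop : Filter.Tendsto (robinParameter f α L₀) Filter.atTop (nhds 0) := by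
    have h := (((hf.tendsto_halfTime_atTop hk hsuper).const_mul 2).div_const L₀).pow 2
    rwa [mul_zero, zero_div, zero_pow two_ne_zero] at h
  have hinj : ∀ a b, 0 < a → 0 < b → robinParameter f α L₀ a = robinParameter f α L₀ b →
      halfTime f (2 / (α * L₀)) a = halfTime f (2 / (α * L₀)) b := fun a b ha hb h => by
    have h1 := hf.halfTime_pos hk ha
    have h2 := hf.halfTime_pos hk hb
    have := (pow_left_inj₀ (by positivity) (by positivity) two_ne_zero).1 h
    field_simp at this
    linarith
  obtain ⟨m, hm, hmon, hanti, hmax, hsurj⟩ := exists_unimodal (g := robinParameter f α L₀)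
    (((continuousOn_const.mul (hf.continuousOn_halfTime hk)).div_const L₀).pow 2) hlampos hzero htop
    fun a b c ha hab hbc h1 h2 => hf.halfTime_not_three hk hsc ha hab hbc
      (hinj a b ha (ha.trans hab) h1) (hinj b c (ha.trans hab) (ha.trans (hab.trans hbc)) h2)
  refine ⟨robinParameter f α L₀, fun C hC μ => hiff hC μ, hzero, htop, m, hm, hmon, hanti,
    hlampos m hm, fun μ hμ hle => ?_, fun μ hlt => ?_⟩
  · obtain ⟨C, hC, hCμ⟩ := hsurj μ hμ hle
    exact hf.exists_isSolution hα hμ ((hiff hC μ).2 hCμ.symm).2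
  -- A solution would make `μ` a value of `robinParameter`, exceeding its maximum at `m`.
  · rintro ⟨u, hu⟩
    have hμ := (hlampos m hm).trans hlt
    obtain ⟨C, hC, hlen⟩ := hf.exists_isLength hα hμ hL₀ hu
    have := (hiff hC μ).1 ⟨hμ, hlen⟩
    exact absurd (hmax C hC) (not_le.2 (this ▸ hlt))
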